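/- Let $F_p$ ($p\in\mathbb Z$) be the Fibonacci numbers, $F_0=0$, $F_1=1$, $F_{p+2}=F_{p+1}+F_p$ for all integers $p$ (so $F_{-p}=(-1)^{p+1}F_p$), and let $L_p$ be the Lucas numbers, $L_0=2$, $L_1=1$, $L_{p+2}=L_{p+1}+L_p$. Let $n$ and $k$ be integers with $3\le k\le n-3$. The bent linear 2-tree with $n$ vertices and a single bend at vertex $k$ is the simple graph on $\{1,\dots,n\}$ in which two vertices are adjacent if and only if their labels differ by $1$ or $2$, except that $k+1$ and $k+3$ are not adjacent, while $k$ and $k+3$ are adjacent. **Theorem.** Put $m=n-2$ (the number of triangles), let every edge of the bent linear 2-tree with $n$ vertices and bend at vertex $k$ be a unit resistor, and let $r_{m,k}(1,n)$ be the resistance distance between the vertices $1$ and $n$, that is, $r_{m,k}(1,n)=v_1-v_n$ where $v\in\mathbb R^n$ is any solution of $\mathcal{L}v=e_1-e_n$ and $\mathcal{L}$ is the Laplacian matrix of the graph. Then $$r_{m,k}(1,n)=\frac{m+1}{5}+\frac{4F_{m+1}}{5L_{m+1}}+\frac{\sum_{j=3}^{k}(-1)^jF_{m-2j+3}\left(F_{m+2}+F_{j-2}F_{m-j+1}\right)}{F_{2m+2}}.$$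 -/

import Mathlib

namespace BentTwoTree

open Matrix

/-- The Lucas numbers: `L 0 = 2`, `L 1 = 1`, `L (n + 2) = L n + L (n + 1)`. -/
def lucas : ℕ → ℕ
  | 0 => 2
  | 1 => 1
  | n + 2 => lucas n + lucas (n + 1)

section Resistance

variable {V : Type*} [Fintype V] [DecidableEq V]

/-- `v` is a vector of node potentials for the circuit with underlying graph `G` and a unit
resistor on every edge, when one unit of current enters at `i` and leaves at `j`: by Kirchhoff's
and Ohm's laws this says `L(G) v = e_i - e_j`, with `L(G)` the graph Laplacian. -/
def IsPotential (G : SimpleGraph V) [DecidableRel G.Adj] (i j : V) (v : V → ℝ) : Prop :=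
  G.lapMatrix ℝ *ᵥ v = Pi.single i 1 - Pi.single j 1

open scoped Classical in
/-- The resistance distance (effective resistance) between `i` and `j`: the potential difference
`v i - v j` that drives one unit of current from `i` to `j`. It does not depend on the potential
(`resistance_eq`), and on a connected graph a potential exists (`exists_isPotential`); where there
is none, the value is the junk value `0`. -/
noncomputable def resistance (G : SimpleGraph V) [DecidableRel G.Adj] (i j : V) : ℝ :=
  if h : ∃ v, IsPotential G i j v then h.choose i - h.choose j else 0

/-- All potentials give the same potential difference. -/
theorem IsPotential.sub_eq {G : SimpleGraph V} [DecidableRel G.Adj] {i j : V} {v w : V → ℝ}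
    (hv : IsPotential G i j v) (hw : IsPotential G i j w) : v i - v j = w i - w j := by
  have hs : (G.lapMatrix ℝ)ᵀ = G.lapMatrix ℝ := G.isSymm_lapMatrix ℝ
  have key : v ⬝ᵥ (G.lapMatrix ℝ *ᵥ w) = w ⬝ᵥ (G.lapMatrix ℝ *ᵥ v) := by
    rw [dotProduct_mulVec, ← mulVec_transpose, hs, dotProduct_comm]
  rw [hv, hw] at key
  simpa [dotProduct_sub] using key

theorem resistance_eq {G : SimpleGraph V} [DecidableRel G.Adj] {i j : V} {v : V → ℝ}
    (hv : IsPotential G i j v) : resistance G i j = v i - v j := by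
  have h : ∃ v, IsPotential G i j v := ⟨v, hv⟩
  rw [resistance, dif_pos h]
  exact h.choose_spec.sub_eq hv

/-- On a connected graph a potential exists for every pair of nodes. -/
theorem exists_isPotential {G : SimpleGraph V} [DecidableRel G.Adj] (hG : G.Connected)
    (i j : V) : ∃ v, IsPotential G i j v := by
  have hne : Nonempty V := hG.nonempty
  set J : Matrix V V ℝ := Matrix.of fun _ _ => 1 with hJ
  have hs : (G.lapMatrix ℝ)ᵀ = G.lapMatrix ℝ := G.isSymm_lapMatrix ℝ
  have hcol (v : V → ℝ) : ∑ a, (G.lapMatrix ℝ *ᵥ v) a = 0 := by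
    have h1 : (fun _ => (1 : ℝ)) ⬝ᵥ (G.lapMatrix ℝ *ᵥ v) = 0 := by
      rw [dotProduct_mulVec, ← mulVec_transpose, hs, G.lapMatrix_mulVec_const_eq_zero]
      simp
    simpa [dotProduct] using h1
  have hJv (v : V → ℝ) (a : V) : (J *ᵥ v) a = ∑ b, v b := by
    simp [hJ, mulVec, dotProduct]
  have hcard : (Fintype.card V : ℝ) ≠ 0 := by exact_mod_cast Fintype.card_ne_zero
  have hsum (v s : V → ℝ) (h : (G.lapMatrix ℝ + J) *ᵥ v = s) (hs0 : ∑ a, s a = 0) :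
      ∑ b, v b = 0 := by
    rw [← h] at hs0
    simp only [add_mulVec, Pi.add_apply, Finset.sum_add_distrib, hcol, hJv, Finset.sum_const,
      Finset.card_univ, nsmul_eq_mul, zero_add] at hs0
    exact (mul_eq_zero.mp hs0).resolve_left hcard
  have hinj : Function.Injective (mulVecLin (G.lapMatrix ℝ + J)) := by
    rw [← LinearMap.ker_eq_bot, LinearMap.ker_eq_bot']
    intro v hv
    rw [mulVecLin_apply] at hv
    have h0 := hsum v 0 hv (by simp)
    have hL : G.lapMatrix ℝ *ᵥ v = 0 := by
      ext a
      have := congrFun hv a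
      simpa [add_mulVec, hJv, h0] using this
    have hc := (G.lapMatrix_mulVec_eq_zero_iff_forall_reachable).mp hL
    ext a
    have hconst : ∑ b, v b = Fintype.card V * v a := by
      rw [Finset.sum_congr rfl fun b _ => hc b a (hG.preconnected b a)]
      simp
    rw [hconst] at h0
    exact (mul_eq_zero.mp h0).resolve_left hcard
  obtain ⟨v, hv⟩ := LinearMap.injective_iff_surjective.mp hinj (Pi.single i 1 - Pi.single j 1)
  rw [mulVecLin_apply] at hv
  have h0 := hsum v _ hv (by simp)
  refine ⟨v, ?_⟩
  ext a
  have := congrFun hv a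
  simpa [add_mulVec, hJv, h0] using this

end Resistance

/-- Adjacency of the vertices labelled `i` and `j` in the bent linear 2-tree with its bend at
vertex `k`: labels at distance one or two are adjacent, except that `k + 1` is not joined
to `k + 3`; instead `k` is joined to `k + 3`. -/
def BentAdj (k i j : ℕ) : Prop :=
  j = i + 1 ∨ i = j + 1 ∨ (j = i + 2 ∧ i ≠ k + 1) ∨ (i = j + 2 ∧ i ≠ k + 3) ∨
    (j = i + 3 ∧ i = k) ∨ (i = j + 3 ∧ i = k + 3)

instance (k i j : ℕ) : Decidable (BentAdj k i j) := by
  unfold BentAdj; infer_instance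

/-- The bent linear 2-tree on `n` vertices with a single bend at vertex `k`. The vertices are
labelled `1, …, n`; the element `a` of `Fin n` is the vertex with label `a + 1`. -/
def bentLinearTwoTree (n k : ℕ) : SimpleGraph (Fin n) where
  Adj a b := BentAdj k (a + 1) (b + 1)
  symm := ⟨fun a b h => by unfold BentAdj at *; omega⟩
  loopless := ⟨fun a h => by unfold BentAdj at h; omega⟩

instance (n k : ℕ) : DecidableRel (bentLinearTwoTree n k).Adj := fun a b =>
  inferInstanceAs (Decidable (BentAdj k (a + 1) (b + 1)))

end BentTwoTree

open BentTwoTree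

/-! Let `d j` be the potential drop between consecutive vertices. A unit current crosses every cut
between labels `≤ i` and `> i`, which away from the bend says `d i + 3 * d (i + 1) + d (i + 2) = 1`.
The constant `1/5` solves this; the homogeneous solutions are spanned by (-1)^z F_{2z} and (-1)^z
F_{2z+1}. Each end condition leaves one parameter per side of the bend, `A` and `B`. The three cuts
at the bend fix the middle drop and give a 2×2 system for `A`, `B`, whose determinant is ±F_{2m+2} =
±F_{m+1}L_{m+1}: hence the denominator (`resistance_eq_of_recurrence`). The resistance, a sum of
drops, telescopes by the recurrence. The sum in the theorem also has a closed form (`sum_fib_eq`),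
and the two agree by Cassini's identity (`potential_identity`, `closed_form_identity`). -/

/-! ### Kirchhoff's laws as cut equations -/

theorem bentLinearTwoTree_lapMatrix_mulVec (n k : ℕ) (V : ℕ → ℝ) (a : Fin n) :
    ((bentLinearTwoTree n k).lapMatrix ℝ).mulVec (fun b => V b) a =
      (if (a : ℕ) + 1 < n then V a - V (a + 1) else 0)
      + (if 1 ≤ (a : ℕ) then V a - V (a - 1) else 0)
      + (if (a : ℕ) + 2 < n ∧ (a : ℕ) ≠ k then V a - V (a + 2) else 0)
      + (if 2 ≤ (a : ℕ) ∧ (a : ℕ) ≠ k + 2 then V a - V (a - 2) else 0)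
      + (if (a : ℕ) + 3 < n ∧ (a : ℕ) + 1 = k then V a - V (a + 3) else 0)
      + (if 3 ≤ (a : ℕ) ∧ (a : ℕ) = k + 2 then V a - V (a - 3) else 0) := by
  obtain ⟨a, ha⟩ := a
  have single (p : Prop) [Decidable p] (c : ℕ) :
      ∑ b ∈ Finset.range n, (if b = c ∧ p then V a - V b else 0)
        = if c < n ∧ p then V a - V c else 0 := by
    by_cases hp : p <;> simp [hp, Finset.sum_ite_eq']
  have hrow : ((bentLinearTwoTree n k).lapMatrix ℝ).mulVec (fun b => V b) ⟨a, ha⟩ =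
      ∑ b ∈ Finset.range n, if BentAdj k (a + 1) (b + 1) then V a - V b else 0 := by
    rw [SimpleGraph.lapMatrix_mulVec_apply, ← SimpleGraph.card_neighborFinset_eq_degree,
      ← nsmul_eq_mul, ← Finset.sum_const, ← Finset.sum_sub_distrib,
      Finset.sum_range (fun b => if BentAdj k (a + 1) (b + 1) then V a - V b else 0),
      SimpleGraph.neighborFinset_eq_filter, Finset.sum_filter]
    rfl
  have hsplit (b : ℕ) : (if BentAdj k (a + 1) (b + 1) then V a - V b else 0) =
      (if b = a + 1 ∧ 0 ≤ a then V a - V b else 0)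
      + (if b = a - 1 ∧ 1 ≤ a then V a - V b else 0)
      + (if b = a + 2 ∧ a ≠ k then V a - V b else 0)
      + (if b = a - 2 ∧ 2 ≤ a ∧ a ≠ k + 2 then V a - V b else 0)
      + (if b = a + 3 ∧ a + 1 = k then V a - V b else 0)
      + (if b = a - 3 ∧ 3 ≤ a ∧ a = k + 2 then V a - V b else 0) := by
    grind [BentAdj]
  rw [hrow, Finset.sum_congr rfl fun b _ => hsplit b]
  simp only [Finset.sum_add_distrib, single]
  have h1 : a - 1 < n := by omega
  have h2 : a - 2 < n := by omega
  have h3 : a - 3 < n := by omega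
  simp only [h1, h2, h3, true_and, Nat.zero_le, and_true]

-- Each recurrence hypothesis says that one unit of current crosses one cut; Kirchhoff's law at a
-- vertex is the difference of the two cuts around it. The drops `d 0` and `d n` are fictitious:
-- `hfirst` and `hlast` choose them so that the generic equation also holds at the end cuts.
set_option maxHeartbeats 1600000 in
theorem isPotential_of_cut_eq (n k : ℕ) (hk : 3 ≤ k) (hkn : k + 3 ≤ n) (d : ℕ → ℝ)
    (hfirst : d 0 + d 1 = 0)
    (hleft : ∀ i, i + 1 < k → d i + 3 * d (i + 1) + d (i + 2) = 1)
    (hbend₀ : d (k - 1) + 4 * d k + 2 * d (k + 1) + d (k + 2) = 1)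
    (hbend₁ : 2 * d k + 3 * d (k + 1) + d (k + 2) = 1)
    (hbend₂ : d k + d (k + 1) + 3 * d (k + 2) + d (k + 3) = 1)
    (hright : ∀ i, k + 2 ≤ i → d i + 3 * d (i + 1) + d (i + 2) = 1)
    (hlast : d (n - 1) + d n = 0) :
    IsPotential (bentLinearTwoTree n k) ⟨0, by omega⟩ ⟨n - 1, by omega⟩
      (fun a => -∑ j ∈ Finset.range (a + 1), d j) := by
  obtain ⟨V, hV⟩ : ∃ V : ℕ → ℝ, V = fun a => -∑ j ∈ Finset.range (a + 1), d j := ⟨_, rfl⟩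
  have hd (a : ℕ) : V (a + 1) = V a - d (a + 1) := by
    simp only [hV]; rw [Finset.sum_range_succ _ (a + 1)]; ring
  have hfun : (fun a : Fin n => -∑ j ∈ Finset.range ((a : ℕ) + 1), d j) =
      fun a : Fin n => V a := by
    rw [hV]
  rw [hfun]
  unfold IsPotential
  ext ⟨a, ha⟩
  rw [bentLinearTwoTree_lapMatrix_mulVec]
  simp only [Pi.sub_apply, Pi.single_apply, Fin.mk.injEq]
  obtain ⟨k, rfl⟩ : ∃ l, k = l + 3 := ⟨k - 3, by omega⟩
  simp only [show k + 3 - 1 = k + 2 by omega, add_assoc, Nat.reduceAdd] at *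
  match a, ha with
  | 0, ha =>
    have r0 := hleft 0 (by omega)
    have e1 := hd 0
    have e2 := hd 1
    norm_num at *
    split_ifs <;> first | (exfalso; omega) | linarith
  | 1, ha =>
    have r0 := hleft 0 (by omega)
    have r1 := hleft 1 (by omega)
    have e1 := hd 0
    have e2 := hd 1
    have e3 := hd 2
    norm_num at *
    split_ifs <;> first | (exfalso; omega) | linarith
  | a + 2, ha =>
    have e1 := hd a
    have e2 := hd (a + 1)
    have e3 := hd (a + 2)
    have e4 := hd (a + 3)
    have e5 := hd (a + 4)
    simp only [show a + 2 - 1 = a + 1 by omega, show a + 2 - 2 = a by omega, add_assoc,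
      Nat.reduceAdd] at *
    -- Index `a + 2` carries label `a + 3` and the bend now has label `k + 3`, so `a = k` is the
    -- bend vertex. The next three vertices also border a bend cut.
    by_cases c : a < k
    · have r0 := hleft (a + 1) (by omega)
      have r1 := hleft (a + 2) (by omega)
      simp only [add_assoc, Nat.reduceAdd] at r0 r1
      split_ifs <;> first | (exfalso; omega) | linarith
    by_cases c0 : a = k
    · subst c0
      have r0 := hleft (a + 1) (by omega)
      simp only [add_assoc, Nat.reduceAdd] at r0
      split_ifs <;> first | (exfalso; omega) | linarith
    by_cases c1 : a = k + 1
    · subst c1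
      simp only [add_assoc, Nat.reduceAdd] at *
      split_ifs <;> first | (exfalso; omega) | linarith
    by_cases c2 : a = k + 2
    · subst c2
      simp only [add_assoc, Nat.reduceAdd] at *
      by_cases hn : n = k + 6
      · subst hn
        simp only [show k + 6 - 1 = k + 5 by omega] at *
        split_ifs <;> first | (exfalso; omega) | linarith
      · split_ifs <;> first | (exfalso; omega) | linarith
    by_cases c3 : a = k + 3
    · subst c3
      have e0 := hd (k + 2)
      have r0 := hright (k + 5) (by omega)
      simp only [show k + 3 + 2 - 3 = k + 2 by omega, add_assoc, Nat.reduceAdd, ne_eq,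
        not_true_eq_false, and_true, and_false, if_false] at *
      by_cases hn : n = k + 6
      · subst hn
        simp only [show k + 6 - 1 = k + 5 by omega] at *
        split_ifs <;> first | (exfalso; omega) | linarith
      by_cases hn : n = k + 7
      · subst hn
        simp only [show k + 7 - 1 = k + 6 by omega] at *
        split_ifs <;> first | (exfalso; omega) | linarith
      · split_ifs <;> first | (exfalso; omega) | linarith
    · have r0 := hright (a + 1) (by omega)
      have r1 := hright (a + 2) (by omega)
      simp only [add_assoc, Nat.reduceAdd] at r0 r1
      by_cases hn : n = a + 3
      · subst hn
        simp only [show a + 3 - 1 = a + 2 by omega] at *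
        split_ifs <;> first | (exfalso; omega) | linarith
      by_cases hn : n = a + 4
      · subst hn
        simp only [show a + 4 - 1 = a + 3 by omega] at *
        split_ifs <;> first | (exfalso; omega) | linarith
      · split_ifs <;> first | (exfalso; omega) | linarith

/-! ### Gluing solutions of the recurrence across the bend -/

theorem five_mul_sum_Ico_eq (u : ℤ → ℝ) (hu : ∀ z, u (z - 1) + 3 * u z + u (z + 1) = 0)
    (p r : ℕ) (hpr : p ≤ r) :
    5 * ∑ i ∈ Finset.Ico p r, u i = -u (p - 1) + u p + u (r - 1) - u r := by
  induction r, hpr using Nat.le_induction with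
  | base => simp
  | succ r hr ih =>
    rw [Finset.sum_Ico_succ_top hr, mul_add, ih]
    have := hu r
    push_cast
    rw [add_sub_cancel_right]
    linarith

theorem resistance_eq_of_recurrence (n k : ℕ) (hk : 3 ≤ k) (hkn : k + 3 ≤ n) (u w : ℤ → ℝ)
    (hu : ∀ z, u (z - 1) + 3 * u z + u (z + 1) = 0)
    (hw : ∀ z, w (z - 1) + 3 * w z + w (z + 1) = 0)
    (hu0 : u 0 + u 1 = -2 / 5) (hwn : w (n - 1) + w n = -2 / 5)
    (h₁ : u (k + 1) + w (k + 1) = 3 / 5) (h₂ : u (k + 2) + w (k + 2) = -7 / 5) :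
    resistance (bentLinearTwoTree n k) ⟨0, by omega⟩ ⟨n - 1, by omega⟩ =
      ((n : ℝ) - 1) / 5 + (2 / 5 - u k - u (k + 1)) + (-u 0 + u 1 + u k - u (k + 1)) / 5
        + (-w (k + 1) + w (k + 2) + w (n - 1) - w n) / 5 := by
  -- The middle value comes from subtracting the second bend equation from the first and using the
  -- recurrence for `u` at `k`. The third and second bend equations then reduce to `h₁` and `h₂`.
  obtain ⟨d, hd⟩ : ∃ d : ℕ → ℝ, d = fun i : ℕ => 1 / 5 + if i ≤ k then u i else
    if i = k + 1 then 2 / 5 - u k - u (k + 1) else w i := ⟨_, rfl⟩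
  have dl (i : ℕ) (hi : i ≤ k) : d i = 1 / 5 + u i := by simp [hd, hi]
  have dm : d (k + 1) = 1 / 5 + (2 / 5 - u k - u (k + 1)) := by simp [hd]
  have dr (i : ℕ) (hi : k + 2 ≤ i) : d i = 1 / 5 + w i := by
    simp [hd, show ¬ i ≤ k by omega, show i ≠ k + 1 by omega]
  have hu' (z : ℤ) : u z + 3 * u (z + 1) + u (z + 2) = 0 := by
    have := hu (z + 1)
    rwa [add_sub_cancel_right, add_assoc z, one_add_one_eq_two] at this
  have hw' (z : ℤ) : w z + 3 * w (z + 1) + w (z + 2) = 0 := by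
    have := hw (z + 1)
    rwa [add_sub_cancel_right, add_assoc z, one_add_one_eq_two] at this
  have uk := hu k
  have uk1 := hu' k
  have wk := hw' (k + 1)
  rw [show (k : ℤ) + 1 + 1 = k + 2 by ring, show (k : ℤ) + 1 + 2 = k + 3 by ring] at wk
  have dk := dl k le_rfl
  have dk2 := dr (k + 2) le_rfl
  have dk3 := dr (k + 3) (by omega)
  push_cast at dk2 dk3
  have hpot := isPotential_of_cut_eq n k hk hkn d
    (by rw [dl 0 (by omega), dl 1 (by omega)]; push_cast; linarith)
    (fun i hi => by
      rw [dl i (by omega), dl (i + 1) (by omega), dl (i + 2) (by omega)]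
      have := hu' i
      push_cast
      linarith)
    (by
      rw [dl (k - 1) (by omega), dk, dm, dk2]
      push_cast [show 1 ≤ k by omega]
      linarith)
    (by rw [dk, dm, dk2]; linarith)
    (by rw [dk, dm, dk2, dk3]; linarith)
    (fun i hi => by
      rw [dr i (by omega), dr (i + 1) (by omega), dr (i + 2) (by omega)]
      have := hw' i
      push_cast
      linarith)
    (by
      rw [dr (n - 1) (by omega), dr n (by omega)]
      push_cast [show 1 ≤ n by omega]
      linarith)
  rw [resistance_eq hpot]
  have hn : n - 1 + 1 = n := by omega
  simp only [hn, zero_add, Finset.sum_range_one]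
  have hsum : ∑ j ∈ Finset.range n, d j = d 0 + ∑ j ∈ Finset.Ico 1 (k + 1), d j + d (k + 1)
      + ∑ j ∈ Finset.Ico (k + 2) n, d j := by
    rw [Finset.range_eq_Ico, ← Finset.sum_Ico_consecutive d (Nat.zero_le (k + 2)) (by omega),
      Finset.sum_Ico_succ_top (by omega), Finset.sum_eq_sum_Ico_succ_bot (by omega)]
  have hl : ∑ j ∈ Finset.Ico 1 (k + 1), d j
      = k / 5 + ∑ j ∈ Finset.Ico 1 (k + 1), u j := by
    rw [Finset.sum_congr rfl fun j hj => dl j (by rw [Finset.mem_Ico] at hj; omega),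
      Finset.sum_add_distrib]
    simp; ring
  have hr : ∑ j ∈ Finset.Ico (k + 2) n, d j
      = ((n : ℝ) - k - 2) / 5 + ∑ j ∈ Finset.Ico (k + 2) n, w j := by
    rw [Finset.sum_congr rfl fun j hj => dr j (by rw [Finset.mem_Ico] at hj; omega),
      Finset.sum_add_distrib]
    simp [Nat.cast_sub (show k + 2 ≤ n by omega)]; ring
  have hus := five_mul_sum_Ico_eq u hu 1 (k + 1) (by omega)
  have hws := five_mul_sum_Ico_eq w hw (k + 2) n (by omega)
  push_cast at hus hws
  rw [add_sub_cancel_right] at hus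
  rw [show (k : ℤ) + 2 - 1 = k + 1 by ring] at hws
  rw [hsum, hl, hr, dm]
  linarith

/-! ### Fibonacci identities -/

/-- The Fibonacci numbers with integer index, as real numbers. -/
noncomputable def realFib (z : ℤ) : ℝ := Int.fib z

theorem realFib_add_two (z : ℤ) : realFib (z + 2) = realFib z + realFib (z + 1) := by
  simp only [realFib]; exact_mod_cast Int.fib_add_two z

theorem realFib_add (x y : ℤ) :
    realFib (x + y) = (realFib (x + 1) - realFib x) * realFib y + realFib x * realFib (y + 1) := by
  have h := realFib_add_two (x - 1)
  rw [show x - 1 + 2 = x + 1 by ring, sub_add_cancel] at h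
  have h' : realFib (x + y) = realFib (x - 1) * realFib y + realFib x * realFib (y + 1) := by
    simp only [realFib]; exact_mod_cast Int.fib_add x y
  rw [h', h]; ring

theorem realFib_neg (z : ℤ) : realFib (-z) = -(-1) ^ z * realFib z := by
  rw [realFib, realFib, Int.fib_neg]
  split_ifs with h
  · simp [h.neg_one_zpow]
  · simp [(Int.not_even_iff_odd.mp h).neg_one_zpow]

theorem realFib_sub (x y : ℤ) : realFib (x - y) =
    (-1) ^ y * (realFib x * realFib (y + 1) - realFib (x + 1) * realFib y) := by
  have h := realFib_add_two (y - 1)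
  rw [show y - 1 + 2 = y + 1 by ring, sub_add_cancel] at h
  rw [sub_eq_add_neg, realFib_add, realFib_neg, show -y + 1 = -(y - 1) by ring, realFib_neg,
    zpow_sub_one₀ (by norm_num), h]
  ring

theorem realFib_cassini (z : ℤ) :
    realFib (z + 1) ^ 2 - realFib (z + 1) * realFib z - realFib z ^ 2 = (-1) ^ z := by
  have h := realFib_sub z z
  have h1 := realFib_sub (z + 1) z
  have h2 := realFib_add_two z
  have hs : ((-1 : ℝ) ^ z) ^ 2 = 1 := by
    rw [← zpow_natCast, ← zpow_mul, mul_comm, zpow_mul]; norm_num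
  rw [show z + 1 - z = 1 by ring, show z + 1 + 1 = z + 2 by ring, h2] at h1
  simp only [show realFib 1 = 1 by simp [realFib]] at h1
  linear_combination (-(-1) ^ z) * h1 - (realFib (z + 1) ^ 2 - realFib (z + 1) * realFib z - realFib z ^ 2) * hs

theorem realFib_two_mul (z : ℤ) :
    realFib (2 * z) = realFib z * (2 * realFib (z + 1) - realFib z) := by
  rw [two_mul, realFib_add]; ring

theorem realFib_two_mul_add_one (z : ℤ) :
    realFib (2 * z + 1) = realFib (z + 1) ^ 2 + realFib z ^ 2 := by
  rw [show 2 * z + 1 = z + (z + 1) by ring, realFib_add, add_assoc z, one_add_one_eq_two,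
    realFib_add_two]
  ring

/-- Since 5(F_{m+2} + F_{j-2}F_{m-j+1}) = 4L_{m+1} - (-1)^j L_{m-2j+3}, five times the summand is
4L_{m+1}(-1)^j F_{m-2j+3} - F_{2(m-2j+3)}, and both terms telescope. The factor `8 * realFib m + 4 *
realFib (m + 1)` is 4L_{m+1}. -/
theorem sum_fib_eq (m : ℤ) (k : ℕ) (hk : 2 ≤ k) :
    25 * ∑ j ∈ Finset.Icc 3 k, (-1 : ℝ) ^ j * realFib (m - 2 * j + 3) *
        (realFib (m + 2) + realFib (j - 2) * realFib (m - j + 1)) =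
      (8 * realFib m + 4 * realFib (m + 1)) *
          ((-1) ^ k * (realFib (m - 2 * k) + 3 * realFib (m - 2 * k + 1))
            - (3 * realFib (m + 1) - 4 * realFib m))
        - (7 * realFib (2 * m + 1) - 11 * realFib (2 * m))
        + (4 * realFib (2 * (m - 2 * k)) + 7 * realFib (2 * (m - 2 * k) + 1)) := by
  induction k, hk using Nat.le_induction with
  | base =>
    have e5 : realFib (-5) = 5 := by simp [realFib, Int.fib]; norm_num [Nat.fib]
    have e4 : realFib (-4) = -3 := by simp [realFib, Int.fib]; norm_num [Nat.fib]
    have e3 : realFib (-3) = 2 := by simp [realFib, Int.fib]; norm_num [Nat.fib]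
    have e2 : realFib (-2) = -1 := by simp [realFib, Int.fib]
    have h4 : realFib (m - 2 * ((2 : ℕ) : ℤ)) = 5 * realFib m - 3 * realFib (m + 1) := by
      rw [show m - 2 * ((2 : ℕ) : ℤ) = m + -4 by push_cast; ring, realFib_add]
      norm_num [e3, e4]; ring
    have h3 : realFib (m - 2 * ((2 : ℕ) : ℤ) + 1) = 2 * realFib (m + 1) - 3 * realFib m := by
      rw [show m - 2 * ((2 : ℕ) : ℤ) + 1 = m + -3 by push_cast; ring, realFib_add]
      norm_num [e2, e3]; ring
    simp only [realFib_two_mul, realFib_two_mul_add_one, h3, h4,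
      Finset.Icc_eq_empty_of_lt (show 2 < 3 by norm_num), Finset.sum_empty]
    ring
  | succ k hk ih =>
    obtain ⟨q, rfl⟩ : ∃ q, m = k + q := ⟨m - k, by ring⟩
    rw [Finset.sum_Icc_succ_top (by omega), mul_add, ih]
    have hs : ((-1 : ℝ) ^ k) ^ 2 = 1 := by rw [← pow_mul, mul_comm, pow_mul]; norm_num
    obtain ⟨s, hs'⟩ : ∃ s : ℝ, s = (-1) ^ k := ⟨_, rfl⟩
    have hm := realFib_add k q
    have hm1 := realFib_add (k + 1) q
    rw [show (k : ℤ) + 1 + 1 = k + 2 by ring, realFib_add_two,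
      show (k : ℤ) + 1 + q = k + q + 1 by ring] at hm1
    have hp := realFib_sub q k
    have hp1 := realFib_sub (q + 1) k
    rw [show q + 1 + 1 = q + 2 by ring, realFib_add_two, show q + 1 - k = q - k + 1 by ring] at hp1
    have hq1 := realFib_add_two (q - k - 1)
    have hq0 := realFib_add_two (q - k - 2)
    rw [show q - k - 1 + 2 = q - k + 1 by ring, show q - k - 1 + 1 = q - k by ring] at hq1
    rw [show q - k - 2 + 2 = q - k by ring, show q - k - 2 + 1 = q - k - 1 by ring] at hq0
    have hk1 := realFib_add_two (k - 1)
    rw [show (k : ℤ) - 1 + 2 = k + 1 by ring, show (k : ℤ) - 1 + 1 = k by ring] at hk1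
    simp only [realFib_two_mul, realFib_two_mul_add_one, pow_succ _ k, Nat.cast_succ,
      realFib_add_two,
      show (k : ℤ) + q - 2 * k = q - k by ring,
      show (k : ℤ) + q - 2 * (k + 1) = q - k - 2 by ring,
      show (q : ℤ) - k - 2 + 1 = q - k - 1 by ring,
      show (q : ℤ) - k - 2 + 3 = q - k + 1 by ring,
      show (k : ℤ) + 1 - 2 = k - 1 by ring,
      show (k : ℤ) + q - (k + 1) + 1 = q by ring]
    rw [zpow_natCast] at hp hp1
    rw [← hs'] at hp hp1 hs ⊢
    rw [show realFib (q - k - 1) = realFib (q - k + 1) - realFib (q - k) by linarith,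
      show realFib (k - 1) = realFib (k + 1) - realFib k by linarith,
      show realFib (q - k - 2) = 2 * realFib (q - k) - realFib (q - k + 1) by linarith]
    -- This is 5F_{k-1}F_q = L_{m-1} + (-1)^k L_{q-k+1} with m = k + q, linearising the product in
    -- the new summand.
    have key : s * (realFib (q - k + 1) + 2 * realFib (q - k))
        + 3 * realFib (k + q) - realFib (k + q + 1)
        - 5 * (realFib (k + 1) - realFib k) * realFib q = 0 := by
      rw [hp, hp1, hm, hm1]
      linear_combination (realFib (q + 1) * realFib (k + 1)
        - (realFib q + realFib (q + 1)) * realFib k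
        + 2 * (realFib q * realFib (k + 1) - realFib (q + 1) * realFib k)) * hs
    linear_combination 5 * s * realFib (q - k + 1) * key - 5 * realFib (q - k + 1) *
      (realFib (q - k + 1) + 2 * realFib (q - k)) * hs

/-! ### Polynomial identities behind the closed form -/

/-- The left side is 5D times the resistance minus (m+1)/5. Here `DA`, `DB` stand for D·A, D·B from
Cramer's rule, so no division occurs. -/
theorem potential_identity (s t x0 x1 y0 y1 D DA DB R1 R2 : ℝ)
    (hs2 : s ^ 2 = 1) (ht2 : t ^ 2 = 1)
    (hX : x1 ^ 2 - x0 * x1 - x0 ^ 2 = 1) (hY : y1 ^ 2 - y0 * y1 - y0 ^ 2 = 1)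
    (hD : D = x0 * y1 + x1 * (y0 + y1))
    (hR1 : R1 = (-3 - 2 * (s * (x0 + x1) + t * (y0 + y1))) / 5)
    (hR2 : R2 = (-7 - 2 * (s * (2 * x0 + 3 * x1) + t * y0)) / 5)
    (hDA : DA = -s * (R1 * (y1 - y0) - R2 * y1))
    (hDB : DB = -t * (x1 * R2 - (x0 + 2 * x1) * R1)) :
    6 / 5 * D - 4 * (s * (2 / 5 * x0 * D + DA * (x1 - x0)))
        + 6 * (s * (2 / 5 * (x0 + x1) * D + DA * x1)) - 2 * DA - 2 * DB
        + t * (2 / 5 * (y0 + y1) * D + DB * y1) + t * (2 / 5 * y0 * D + DB * (y1 - y0)) =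
      -8/5 * x0 * y1 + 7/5 * x1 * y0 + 16/5 * x1 * y1 + 16/5 * s * y1 + 12/5 * s * y0 - 4/5 *
      t * x1 + 12/5 * t * x0 - 1/5 * x0 * y0 - 8/5 * s * t := by
  subst hDA hDB hR1 hR2 hD
  linear_combination (-12/5 * x0 * y1 - 2/5 * x1 * y0 - 8/5 * x0 * y0 - 4 * s * x0 * x1 * y1 - 8/5 * s * x0
        ^ 2 * y1 - 8/5 * s * x0 ^ 2 * y0 - 8/5 * s * x1 ^ 2 * y1 - 4/5 * s * x1 ^ 2 * y0 - 4/5 *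
        t * x1 * y0 ^ 2 - 8/5 * t * x0 * y0 ^ 2 + 4/5 * t * x1 * y1 ^ 2 + 8/5 * t * x0 * y1 ^ 2
        - 4/5 * t * x1 * y0 * y1 - 8/5 * t * x0 * y0 * y1 - 12/5 * s * x0 * x1 * y0) * hs2 +
        (3/5 * x1 * y0 + 7/5 * x0 * y0 - 2/5 * x0 * y1 + 2 * x1 * y1 - 4/5 * s * x0 * x1 * y1 +
        4/5 * s * x1 ^ 2 * y1 - 4/5 * s * x0 ^ 2 * y1 - 2/5 * t * x0 * y0 * y1 - 4/5 * t * x0 *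
        y1 ^ 2 - 8/5 * t * x1 * y1 ^ 2 + 2/5 * s * x0 * x1 * y0 - 2/5 * s * x1 ^ 2 * y0 + 2/5 *
        t * x1 * y0 ^ 2 + 2/5 * s * x0 ^ 2 * y0 + 2/5 * t * x0 * y0 ^ 2) * ht2 + (6/5 * s * y0 +
        8/5 * s * y1 - 4/5 * s * t) * hX + (-4/5 * s * t + 6/5 * t * x0 - 2/5 * t * x1) * hY

theorem closed_form_identity (P Q U W s t x0 x1 y0 y1 m0 m1 p0 p1 T : ℝ)
    (hs : Q ^ 2 - Q * P - P ^ 2 = s) (ht : W ^ 2 - W * U - U ^ 2 = t) (hs2 : s ^ 2 = 1)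
    (hx0 : x0 = P * (2 * Q - P)) (hx1 : x1 = Q ^ 2 + P ^ 2)
    (hy0 : y0 = U * (2 * W - U)) (hy1 : y1 = W ^ 2 + U ^ 2)
    (hm0 : m0 = (Q - P) * U + P * W) (hm1 : m1 = P * U + Q * W)
    (hp0 : p0 = s * (U * Q - W * P)) (hp1 : p1 = s * (W * Q - (U + W) * P))
    (hT : 25 * T = (8 * m0 + 4 * m1) * (s * (p0 + 3 * p1) - (3 * m1 - 4 * m0))
      - (7 * (m1 ^ 2 + m0 ^ 2) - 11 * (m0 * (2 * m1 - m0)))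
      + (4 * (p0 * (2 * p1 - p0)) + 7 * (p1 ^ 2 + p0 ^ 2))) :
    -8/5 * x0 * y1 + 7/5 * x1 * y0 + 16/5 * x1 * y1 + 16/5 * s * y1 + 12/5 * s * y0 - 4/5 *
      t * x1 + 12/5 * t * x0 - 1/5 * x0 * y0 - 8/5 * s * t = 4 * m1 ^ 2 + 5 * T := by
  -- Every sign in `hT` occurs as `s ^ 2`, so it disappears. Cassini then turns the remaining `s`,
  -- `t` into quadratics in `P, Q, U, W`, leaving a plain polynomial identity.
  obtain ⟨a, ha⟩ : ∃ a, a = U * Q - W * P := ⟨_, rfl⟩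
  obtain ⟨b, hb⟩ : ∃ b, b = W * Q - (U + W) * P := ⟨_, rfl⟩
  rw [← ha] at hp0
  rw [← hb] at hp1
  have hT' : 25 * T = (8 * m0 + 4 * m1) * ((a + 3 * b) - (3 * m1 - 4 * m0))
      - (7 * (m1 ^ 2 + m0 ^ 2) - 11 * (m0 * (2 * m1 - m0)))
      + (4 * (a * (2 * b - a)) + 7 * (b ^ 2 + a ^ 2)) := by
    rw [hT, hp0, hp1]
    linear_combination ((8 * m0 + 4 * m1) * (a + 3 * b) + 4 * (a * (2 * b - a))
      + 7 * (b ^ 2 + a ^ 2)) * hs2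
  clear hT hs2 hp0 hp1
  subst hs ht hx0 hx1 hy0 hy1 hm0 hm1 ha hb
  linear_combination (-1 / 5) * hT'

/-! ### Explicit solutions and the final evaluation -/

theorem lucas_eq_realFib (n : ℕ) : (lucas n : ℝ) = 2 * realFib (n + 1) - realFib n := by
  induction n using Nat.twoStepInduction with
  | zero => simp [lucas, realFib]
  | one =>
    have := realFib_add_two 0
    norm_num [realFib] at this
    simp [lucas, realFib]; norm_num
  | more n h₀ h₁ =>
    rw [lucas]
    push_cast at h₁ ⊢
    rw [h₀, h₁]
    have e₁ := realFib_add_two n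
    have e₂ := realFib_add_two (n + 1)
    rw [show (n : ℤ) + 1 + 2 = n + 2 + 1 by ring] at e₂
    rw [e₂, e₁, show (n : ℤ) + 1 + 1 = n + 2 by ring, e₁]
    ring

theorem realFib_pos {z : ℤ} (hz : 0 < z) : 0 < realFib z := by
  lift z to ℕ using hz.le
  simpa [realFib] using hz

/-- A solution of `u (z - 1) + 3 * u z + u (z + 1) = 0` with `u 0 + u 1 = -2 / 5`. -/
noncomputable def alternatingFib (A : ℝ) (z : ℤ) : ℝ :=
  (-1) ^ z * (2 / 5 * realFib (2 * z) + A * (realFib (2 * z + 1) - realFib (2 * z)))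

theorem alternatingFib_recurrence (A : ℝ) (z : ℤ) :
    alternatingFib A (z - 1) + 3 * alternatingFib A z + alternatingFib A (z + 1) = 0 := by
  have h₁ := realFib_add_two (2 * z - 2)
  have h₂ := realFib_add_two (2 * z - 1)
  have h₃ := realFib_add_two (2 * z)
  have h₄ := realFib_add_two (2 * z + 1)
  rw [sub_add_cancel, show 2 * z - 2 + 1 = 2 * z - 1 by ring] at h₁
  rw [sub_add_cancel, show 2 * z - 1 + 2 = 2 * z + 1 by ring] at h₂
  rw [show 2 * z + 1 + 1 = 2 * z + 2 by ring] at h₄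
  simp only [alternatingFib, zpow_add_one₀ (show (-1 : ℝ) ≠ 0 by norm_num),
    zpow_sub_one₀ (show (-1 : ℝ) ≠ 0 by norm_num), show 2 * (z - 1) = 2 * z - 2 by ring,
    show 2 * z - 2 + 1 = 2 * z - 1 by ring, mul_add, mul_one,
    show 2 * z + 2 + 1 = 2 * z + 1 + 2 by ring, h₄, h₃,
    show realFib (2 * z - 1) = realFib (2 * z + 1) - realFib (2 * z) by linarith,
    show realFib (2 * z - 2) = 2 * realFib (2 * z) - realFib (2 * z + 1) by linarith]
  norm_num
  ring

theorem alternatingFib_zero (A : ℝ) : alternatingFib A 0 = A := by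
  simp [alternatingFib, realFib]

theorem alternatingFib_one (A : ℝ) : alternatingFib A 1 = -2 / 5 - A := by
  have h := realFib_add_two 1
  norm_num [realFib] at h
  simp [alternatingFib, realFib, h]; ring

theorem alternatingFib_add_one (A : ℝ) (z : ℤ) : alternatingFib A (z + 1) =
    -(-1) ^ z * (2 / 5 * (realFib (2 * z) + realFib (2 * z + 1)) + A * realFib (2 * z + 1)) := by
  have h₃ := realFib_add_two (2 * z)
  have h₄ := realFib_add_two (2 * z + 1)
  rw [show 2 * z + 1 + 1 = 2 * z + 2 by ring, h₃] at h₄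
  rw [alternatingFib, zpow_add_one₀ (by norm_num), show 2 * (z + 1) = 2 * z + 2 by ring,
    show 2 * z + 2 + 1 = 2 * z + 1 + 2 by ring, h₄, h₃]
  ring

theorem mainTheorem12 (n m k : ℕ) (hk : 3 ≤ k) (hkn : k + 3 ≤ n) (hm : n = m + 2) :
    BentTwoTree.resistance (BentTwoTree.bentLinearTwoTree n k)
        ⟨0, by omega⟩ ⟨n - 1, by omega⟩ =
      ((m : ℝ) + 1) / 5
        + 4 * (Int.fib ((m : ℤ) + 1) : ℝ) / (5 * (BentTwoTree.lucas (m + 1) : ℝ))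
        + (∑ j ∈ Finset.Icc 3 k, (-1 : ℝ) ^ j * (Int.fib ((m : ℤ) - 2 * (j : ℤ) + 3) : ℝ) *
              ((Int.fib ((m : ℤ) + 2) : ℝ)
                + (Int.fib ((j : ℤ) - 2) : ℝ) * (Int.fib ((m : ℤ) - (j : ℤ) + 1) : ℝ)))
            / (Int.fib (2 * (m : ℤ) + 2) : ℝ) := by
  have hfib (z : ℤ) : (Int.fib z : ℝ) = realFib z := rfl
  simp only [hfib]
  obtain ⟨q, rfl⟩ : ∃ q, m = k + q := ⟨m - k, by omega⟩
  have hT := sum_fib_eq ((k + q : ℕ) : ℤ) k (by omega)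
  set T := ∑ j ∈ Finset.Icc 3 k, (-1 : ℝ) ^ j * realFib (((k + q : ℕ) : ℤ) - 2 * j + 3) *
    (realFib (((k + q : ℕ) : ℤ) + 2) + realFib (j - 2) * realFib (((k + q : ℕ) : ℤ) - j + 1))
  obtain ⟨s, hs⟩ : ∃ s : ℝ, s = (-1) ^ k := ⟨_, rfl⟩
  obtain ⟨t, ht⟩ : ∃ t : ℝ, t = (-1) ^ q := ⟨_, rfl⟩
  have hs2 : s ^ 2 = 1 := by rw [hs, ← pow_mul, mul_comm, pow_mul]; norm_num
  have ht2 : t ^ 2 = 1 := by rw [ht, ← pow_mul, mul_comm, pow_mul]; norm_num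
  have hsc := realFib_cassini k
  have htc := realFib_cassini q
  have hX := realFib_cassini (2 * k)
  have hY := realFib_cassini (2 * q)
  rw [(even_two_mul _).neg_one_zpow] at hX hY
  rw [zpow_natCast, ← hs] at hsc
  rw [zpow_natCast, ← ht] at htc
  have hx0 := realFib_two_mul k
  have hx1 := realFib_two_mul_add_one k
  have hy0 := realFib_two_mul q
  have hy1 := realFib_two_mul_add_one q
  have hm0 := realFib_add k q
  have hm1 := realFib_add (k + 1) q
  rw [show (k : ℤ) + 1 + 1 = k + 2 by ring, realFib_add_two,
    show (k : ℤ) + 1 + q = k + q + 1 by ring, add_sub_cancel_right] at hm1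
  have hp0 := realFib_sub q k
  have hp1 := realFib_sub (q + 1) k
  rw [show (q : ℤ) + 1 + 1 = q + 2 by ring, realFib_add_two,
    show (q : ℤ) + 1 - k = q - k + 1 by ring] at hp1
  rw [zpow_natCast, ← hs] at hp0 hp1
  have hD : realFib (2 * ((k : ℤ) + q) + 2) =
      realFib (k + q + 1) * (2 * realFib (k + q) + realFib (k + q + 1)) := by
    rw [realFib_add_two, realFib_two_mul, realFib_two_mul_add_one]; ring
  have hL : (lucas (k + q + 1) : ℝ) = 2 * realFib (k + q) + realFib (k + q + 1) := by
    rw [lucas_eq_realFib]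
    push_cast
    rw [show (k : ℤ) + q + 1 + 1 = k + q + 2 by ring, realFib_add_two]; ring
  have hm1pos : 0 < realFib ((k : ℤ) + q + 1) := realFib_pos (by omega)
  have hLpos : 0 < 2 * realFib ((k : ℤ) + q) + realFib (k + q + 1) := by
    have := realFib_pos (show 0 < (k : ℤ) + q by omega)
    positivity
  push_cast at hT ⊢
  rw [show (k : ℤ) + q - 2 * k = q - k by ring, ← hs] at hT
  simp only [realFib_two_mul ((k : ℤ) + q), realFib_two_mul_add_one ((k : ℤ) + q),
    realFib_two_mul ((q : ℤ) - k), realFib_two_mul_add_one ((q : ℤ) - k)] at hT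
  rw [hL, hD]
  have hR := closed_form_identity _ _ _ _ s t _ _ _ _ _ _ _ _ T hsc htc hs2 hx0 hx1 hy0 hy1
    hm0 hm1 hp0 hp1 hT
  set x0 := realFib (2 * k)
  set x1 := realFib (2 * k + 1)
  set y0 := realFib (2 * q)
  set y1 := realFib (2 * q + 1)
  set m1 := realFib (k + q + 1)
  set l := 2 * realFib (k + q) + m1
  have hD' : m1 * l = x0 * y1 + x1 * (y0 + y1) := by
    rw [hx0, hx1, hy0, hy1]
    simp only [l]
    rw [hm0, hm1]
    ring
  have hD0 : m1 * l ≠ 0 := by positivity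
  obtain ⟨R1, hR1⟩ : ∃ R1, R1 = (-3 - 2 * (s * (x0 + x1) + t * (y0 + y1))) / 5 := ⟨_, rfl⟩
  obtain ⟨R2, hR2⟩ : ∃ R2, R2 = (-7 - 2 * (s * (2 * x0 + 3 * x1) + t * y0)) / 5 := ⟨_, rfl⟩
  -- Cramer's rule for s x1 A + t y1 B = R1 and s (x0 + 2 x1) A + t (y1 - y0) B = R2, with
  -- determinant -s t m1 l.
  obtain ⟨A, hA⟩ : ∃ A, A * (m1 * l) = -s * (R1 * (y1 - y0) - R2 * y1) :=
    ⟨_, div_mul_cancel₀ _ hD0⟩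
  obtain ⟨B, hB⟩ : ∃ B, B * (m1 * l) = -t * (x1 * R2 - (x0 + 2 * x1) * R1) :=
    ⟨_, div_mul_cancel₀ _ hD0⟩
  have key := potential_identity s t x0 x1 y0 y1 _ _ _ R1 R2 hs2 ht2
    (by rw [← hX]; ring) (by rw [← hY]; ring) hD' hR1 hR2 hA hB
  have uk : alternatingFib A k = s * (2 / 5 * x0 + A * (x1 - x0)) := by
    rw [alternatingFib, zpow_natCast, ← hs]
  have uk1 : alternatingFib A (k + 1) = -s * (2 / 5 * (x0 + x1) + A * x1) := by
    rw [alternatingFib_add_one, zpow_natCast, ← hs]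
  have wq : alternatingFib B q = t * (2 / 5 * y0 + B * (y1 - y0)) := by
    rw [alternatingFib, zpow_natCast, ← ht]
  have wq1 : alternatingFib B (q + 1) = -t * (2 / 5 * (y0 + y1) + B * y1) := by
    rw [alternatingFib_add_one, zpow_natCast, ← ht]
  have uk2 := alternatingFib_recurrence A (k + 1)
  rw [add_sub_cancel_right, uk, uk1, show (k : ℤ) + 1 + 1 = k + 2 by ring] at uk2
  have n1 : (n : ℤ) - (k + 1) = q + 1 := by rw [hm]; push_cast; ring
  have n2 : (n : ℤ) - (k + 2) = q := by rw [hm]; push_cast; ring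
  -- The recurrence is symmetric under z ↦ n - z, so the reflected family meets the condition at the
  -- far end.
  have hres := resistance_eq_of_recurrence n k hk hkn (alternatingFib A)
    (fun z => alternatingFib B (n - z)) (alternatingFib_recurrence A)
    (fun z => by
      have := alternatingFib_recurrence B (n - z)
      rw [show (n : ℤ) - z - 1 = n - (z + 1) by ring,
        show (n : ℤ) - z + 1 = n - (z - 1) by ring] at this
      linarith)
    (by rw [alternatingFib_zero, alternatingFib_one]; ring)
    (by simp only [sub_sub_cancel, sub_self, alternatingFib_zero, alternatingFib_one]; ring)
    (by
      simp only [n1, uk1, wq1]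
      apply mul_right_cancel₀ hD0
      linear_combination -s * x1 * hA - t * y1 * hB
        + x1 * (R1 * (y1 - y0) - R2 * y1) * hs2
        + y1 * (x1 * R2 - (x0 + 2 * x1) * R1) * ht2 - m1 * l * hR1 + R1 * hD')
    (by
      simp only [n2, wq]
      apply mul_right_cancel₀ hD0
      linear_combination m1 * l * uk2 + s * (x0 + 2 * x1) * hA + t * (y1 - y0) * hB
        - (x0 + 2 * x1) * (R1 * (y1 - y0) - R2 * y1) * hs2
        - (y1 - y0) * (x1 * R2 - (x0 + 2 * x1) * R1) * ht2 + m1 * l * hR2 - R2 * hD')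
  rw [hres]
  simp only [n1, n2, uk, uk1, wq, wq1, sub_sub_cancel, sub_self, alternatingFib_zero,
    alternatingFib_one]
  have hn : (n : ℝ) = k + q + 2 := by rw [hm]; push_cast; ring
  have hsplit : 4 * m1 / (5 * l) + T / (m1 * l) = (4 * m1 ^ 2 + 5 * T) / 5 / (m1 * l) := by
    have := hm1pos.ne'
    have := hLpos.ne'
    field_simp
  rw [hn, add_assoc (((k : ℝ) + q + 1) / 5), hsplit, ← hR, ← key]
  field_simp
  ring
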